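/- Let $k$ be an algebraically closed field of characteristic $p>0$, let $q=p^e$ with $e\ge 1$, and let $\mathbb F_{q^2}\subset k$ be the subfield with $q^2$ elements. Let $$F=\sum_{i,j=1}^{4} a_{ij}\,x_i^{q}x_j\in k[x_1,x_2,x_3,x_4]$$ be a Hermitian form, that is, a form whose matrix $A=(a_{ij})$ over $k$ satisfies $a_{ji}^{\,q}=a_{ij}$ for all $i,j$ (so that all $a_{ij}$ lie in $\mathbb F_{q^2}$), and assume that the surface $X=\{F=0\}\subset\mathbb P^3_k$, of degree $q+1$, is smooth. Call a point $P\in\mathbb P^3(k)$ a star point of $X$ if there are $q+1$ distinct lines contained in $X$ that all pass through $P$. Then the star points of $X$ are precisely the $\mathbb F_{q^2}$-rational points of $X$, that is, the points of $X$ that have homogeneous coordinates in $\mathbb F_{q^2}$. -/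

import Mathlib

open scoped LinearAlgebra.Projectivization

namespace ExtremalSurface

noncomputable section

/-- The Frobenius form `(x^[q])ᵀ A x = ∑ i j, a_ij x_i ^ q x_j` with representing matrix `A`. -/
def frobeniusForm {k : Type*} [Field k] {n : ℕ} (q : ℕ) (A : Matrix (Fin n) (Fin n) k) :
    MvPolynomial (Fin n) k :=
  ∑ i, ∑ j, MvPolynomial.C (A i j) * MvPolynomial.X i ^ q * MvPolynomial.X j

/-- A Hermitian form is a Frobenius form whose representing matrix `A` satisfies
`(A^[q])ᵀ = A`, where `A^[q]` is obtained by raising all entries to the `q`-th power. -/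
def IsHermitianForm {k : Type*} [Field k] {n : ℕ} (q : ℕ) (F : MvPolynomial (Fin n) k) : Prop :=
  ∃ A : Matrix (Fin n) (Fin n) k, (A.map (fun a => a ^ q)).transpose = A ∧ F = frobeniusForm q A

/-- The set of points of projective space at which (all homogeneous coordinate vectors of the
point) the homogeneous polynomial `F` of positive degree vanishes. -/
def zeroLocus {k : Type*} [Field k] {n : ℕ} (F : MvPolynomial (Fin n) k) :
    Set (ℙ k (Fin n → k)) :=
  {p | ∀ v ∈ p.submodule, MvPolynomial.eval v F = 0}

/-- The hypersurface `F = 0` in projective space is smooth (Jacobian criterion over an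
algebraically closed field): `F` and its partial derivatives have no common zero besides `0`. -/
def IsSmoothHypersurface {k : Type*} [Field k] {n : ℕ} (F : MvPolynomial (Fin n) k) : Prop :=
  ∀ v : Fin n → k, v ≠ 0 → MvPolynomial.eval v F = 0 →
    ∃ i, MvPolynomial.eval v (MvPolynomial.pderiv i F) ≠ 0

/-- `W`, a linear subspace of `k ^ n`, is (the cone over) a projective line that lies on the
hypersurface `F = 0`. -/
def IsLineOn {k : Type*} [Field k] {n : ℕ} (F : MvPolynomial (Fin n) k)
    (W : Submodule k (Fin n → k)) : Prop :=
  Module.finrank k W = 2 ∧ ∀ p : ℙ k (Fin n → k), p.submodule ≤ W → p ∈ zeroLocus F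

/-- `p` is a star point of the surface `F = 0` of degree `d = deg F` in projective 3-space:
there is a configuration of `d` distinct lines on the surface that all pass through `p`. -/
def IsStarPoint {k : Type*} [Field k] (F : MvPolynomial (Fin 4) k) (p : ℙ k (Fin 4 → k)) : Prop :=
  ∃ S : Finset (Submodule k (Fin 4 → k)),
    S.card = F.totalDegree ∧ ∀ W ∈ S, IsLineOn F W ∧ p.submodule ≤ W

/-- `p` is a `K`-rational point of projective space: it has homogeneous coordinates in `K`. -/
def IsRationalPoint {k : Type*} [Field k] {n : ℕ} (K : Subfield k) (p : ℙ k (Fin n → k)) : Prop :=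
  ∃ (v : Fin n → k) (hv : v ≠ 0), (∀ i, v i ∈ K) ∧ p = Projectivization.mk k v hv

end

end ExtremalSurface

/-! Write h(x, y) = ∑ a_ij x_i^q y_j; it is q-semilinear in x, and smoothness makes it
nondegenerate. Hermitian symmetry reads h(x, y)^q = h(y, x^(q²)), with coordinatewise powers
(`polarFunctional_pow`). If F vanishes on a line, so does h on all pairs from it. Let z^(q²) = x. A
line on X through x then lies in both planes h(x, ·) = 0 and h(z, ·) = 0. If x is not rational, x
and z are independent, the planes differ, and at most one line passes through x
(`isLineOn_unique_of_not_isRationalPoint`). If x is a rational point of X, F restricted to the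
tangent plane T = ker h(x, ·) is a binary form on T modulo x. Nondegeneracy makes its q + 1 roots
distinct, and each root gives a line (`isStarPoint_of_isRationalPoint`). -/

namespace ExtremalSurface

open Module

variable {k : Type*} [Field k] {n : ℕ}

/-- The linear functional `y ↦ (x^[q])ᵀ A y` attached to a vector `x`. -/
noncomputable def polarFunctional (q : ℕ) (A : Matrix (Fin n) (Fin n) k) (x : Fin n → k) :
    Dual k (Fin n → k) :=
  dotProductBilin k k (Matrix.vecMul (x ^ q) A)

theorem polarFunctional_apply (q : ℕ) (A : Matrix (Fin n) (Fin n) k) (x y : Fin n → k) :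
    polarFunctional q A x y = ∑ i, ∑ j, A i j * x i ^ q * y j := by
  change ∑ j, (∑ i, x i ^ q * A i j) * y j = _
  simp only [Finset.sum_mul]
  rw [Finset.sum_comm]
  exact Finset.sum_congr rfl fun i _ => Finset.sum_congr rfl fun j _ => by ring

theorem polarFunctional_single (q : ℕ) (A : Matrix (Fin n) (Fin n) k) (x : Fin n → k) (i : Fin n) :
    polarFunctional q A x (Pi.single i 1) = Matrix.vecMul (x ^ q) A i :=
  dotProduct_single_one _ i

theorem eval_frobeniusForm (q : ℕ) (A : Matrix (Fin n) (Fin n) k) (x : Fin n → k) :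
    MvPolynomial.eval x (frobeniusForm q A) = polarFunctional q A x x := by
  simp [frobeniusForm, polarFunctional_apply]

/-- Derivatives of q-th powers vanish, so only the linear factors contribute. -/
theorem eval_pderiv_frobeniusForm {q : ℕ} (hq : (q : k) = 0) (A : Matrix (Fin n) (Fin n) k)
    (x : Fin n → k) (l : Fin n) :
    MvPolynomial.eval x (MvPolynomial.pderiv l (frobeniusForm q A)) =
      Matrix.vecMul (x ^ q) A l := by
  simp only [frobeniusForm, map_sum, Derivation.leibniz, Derivation.leibniz_pow,
    MvPolynomial.pderiv_C, MvPolynomial.pderiv_X, smul_eq_mul, Matrix.vecMul, dotProduct,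
    Pi.pow_apply, map_add, map_mul, map_pow, MvPolynomial.eval_X, MvPolynomial.eval_C,
    mul_zero, add_zero, nsmul_eq_mul, hq, zero_mul, map_natCast]
  refine Finset.sum_congr rfl fun i _ => ?_
  rw [Finset.sum_eq_single l]
  · simp [mul_comm]
  · intro j _ hj
    simp [hj]
  · simp

theorem frobeniusForm_isHomogeneous (q : ℕ) (A : Matrix (Fin n) (Fin n) k) :
    (frobeniusForm q A).IsHomogeneous (q + 1) := by
  refine MvPolynomial.IsHomogeneous.sum _ _ _ fun i _ =>
    MvPolynomial.IsHomogeneous.sum _ _ _ fun j _ => ?_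
  have h := ((MvPolynomial.isHomogeneous_C (Fin n) (A i j)).mul
    ((MvPolynomial.isHomogeneous_X k i).pow q)).mul (MvPolynomial.isHomogeneous_X k j)
  convert h using 1
  ring

theorem isLineOn_iff {q : ℕ} (A : Matrix (Fin n) (Fin n) k) (W : Submodule k (Fin n → k)) :
    IsLineOn (frobeniusForm q A) W ↔
      finrank k W = 2 ∧ ∀ u ∈ W, polarFunctional q A u u = 0 := by
  refine and_congr_right fun _ => ⟨fun h u hu => ?_, fun h P hP v hv => ?_⟩
  · rw [← eval_frobeniusForm]
    by_cases hu0 : u = 0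
    · rw [eval_frobeniusForm, hu0, map_zero]
    · refine h (Projectivization.mk k u hu0) ?_ u ?_
      · rw [Projectivization.submodule_mk]
        simpa using hu
      · rw [Projectivization.submodule_mk]
        exact Submodule.mem_span_singleton_self u
  · rw [eval_frobeniusForm]
    exact h v (hP hv)

/-! ### Semilinearity, Hermitian symmetry and nondegeneracy of the polar form -/

section CharP

variable {p e : ℕ} [Fact p.Prime] [CharP k p]

theorem polarFunctional_add (A : Matrix (Fin n) (Fin n) k) (x y : Fin n → k) :
    polarFunctional (p ^ e) A (x + y) =
      polarFunctional (p ^ e) A x + polarFunctional (p ^ e) A y := by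
  have h : (x + y) ^ p ^ e = x ^ p ^ e + y ^ p ^ e :=
    funext fun j => add_pow_char_pow (x j) (y j) p e
  simp only [polarFunctional, h, Matrix.add_vecMul, map_add]

theorem polarFunctional_smul (q : ℕ) (A : Matrix (Fin n) (Fin n) k) (c : k) (x : Fin n → k) :
    polarFunctional q A (c • x) = c ^ q • polarFunctional q A x := by
  simp only [polarFunctional]
  rw [← map_smul, ← Matrix.smul_vecMul]
  congr 2
  funext j
  simp [mul_pow]

/-- Hermitian symmetry of the polar form. -/
theorem polarFunctional_pow {A : Matrix (Fin n) (Fin n) k}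
    (hA : (A.map (fun a => a ^ p ^ e)).transpose = A) (x y : Fin n → k) :
    polarFunctional (p ^ e) A x y ^ p ^ e = polarFunctional (p ^ e) A y (x ^ (p ^ e) ^ 2) := by
  simp only [polarFunctional_apply, sum_pow_char_pow]
  rw [Finset.sum_comm]
  refine Finset.sum_congr rfl fun j _ => Finset.sum_congr rfl fun i _ => ?_
  have h : A i j ^ p ^ e = A j i := congrFun (congrFun hA j) i
  rw [mul_pow, mul_pow, h, Pi.pow_apply, sq, pow_mul]
  ring

/-- The gradient at `r` is `Matrix.vecMul (r ^ q) A` and every vector is a q-th power, so a nonzero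
left kernel vector would give a singular point. -/
theorem vecMul_injective_of_isSmooth [IsAlgClosed k] (he : 0 < e) {A : Matrix (Fin n) (Fin n) k}
    (h : IsSmoothHypersurface (frobeniusForm (p ^ e) A)) (w : Fin n → k)
    (hw : Matrix.vecMul w A = 0) : w = 0 := by
  have hp : (p ^ e) ≠ 0 := pow_ne_zero _ (Fact.out : p.Prime).ne_zero
  have hq : ((p ^ e : ℕ) : k) = 0 := by
    rw [Nat.cast_pow, CharP.cast_eq_zero, zero_pow he.ne']
  choose r hr using fun i => IsAlgClosed.exists_pow_nat_eq (w i) (Nat.pos_of_ne_zero hp)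
  have hrw : r ^ p ^ e = w := funext hr
  by_contra hne
  have hr0 : r ≠ 0 := by
    rintro rfl
    exact hne (by rw [← hrw, zero_pow hp])
  obtain ⟨i, hi⟩ := h r hr0 (by
    rw [eval_frobeniusForm, polarFunctional, hrw, hw, map_zero, LinearMap.zero_apply])
  rw [eval_pderiv_frobeniusForm hq, hrw, hw] at hi
  exact hi rfl

theorem totalDegree_of_isSmooth [NeZero n] {q : ℕ} {A : Matrix (Fin n) (Fin n) k}
    (h : IsSmoothHypersurface (frobeniusForm q A)) : (frobeniusForm q A).totalDegree = q + 1 := by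
  refine (frobeniusForm_isHomogeneous q A).totalDegree fun h0 => ?_
  obtain ⟨i, hi⟩ := h (Pi.single 0 1) (by simp) (by rw [h0, map_zero])
  rw [h0] at hi
  simp at hi

theorem linearIndependent_polarFunctional [IsAlgClosed k] {A : Matrix (Fin n) (Fin n) k}
    (hA : ∀ w, Matrix.vecMul w A = 0 → w = 0) {x z : Fin n → k}
    (h : LinearIndependent k ![x, z]) :
    LinearIndependent k ![polarFunctional (p ^ e) A x, polarFunctional (p ^ e) A z] := by
  have hp : (p ^ e) ≠ 0 := pow_ne_zero _ (Fact.out : p.Prime).ne_zero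
  rw [LinearIndependent.pair_iff] at h ⊢
  intro s t hst
  obtain ⟨s, rfl⟩ := IsAlgClosed.exists_pow_nat_eq s (Nat.pos_of_ne_zero hp)
  obtain ⟨t, rfl⟩ := IsAlgClosed.exists_pow_nat_eq t (Nat.pos_of_ne_zero hp)
  rw [← polarFunctional_smul, ← polarFunctional_smul, ← polarFunctional_add] at hst
  have h1 : (s • x + t • z) ^ p ^ e = 0 := by
    refine hA _ (funext fun i => ?_)
    have h2 := LinearMap.congr_fun hst (Pi.single i 1)
    rwa [polarFunctional_single] at h2
  have h3 : s • x + t • z = 0 := funext fun i => pow_eq_zero_iff hp |>.1 (congrFun h1 i)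
  obtain ⟨rfl, rfl⟩ := h s t h3
  exact ⟨zero_pow hp, zero_pow hp⟩

/-- The polars of two independent vectors meet in codimension two. -/
theorem finrank_add_two_le_of_polarFunctional_eq_zero [IsAlgClosed k]
    {A : Matrix (Fin n) (Fin n) k}
    (hA : ∀ w, Matrix.vecMul w A = 0 → w = 0) {x z : Fin n → k}
    (h : LinearIndependent k ![x, z]) :
    finrank k (LinearMap.ker (polarFunctional (p ^ e) A x) ⊓
      LinearMap.ker (polarFunctional (p ^ e) A z) : Submodule k (Fin n → k)) + 2 = n := by
  have h1 := linearIndependent_polarFunctional (p := p) (e := e) hA h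
  have h2 := finrank_span_eq_card h1
  have h3 := Subspace.finrank_add_finrank_dualCoannihilator_eq
    (Submodule.span k (Set.range ![polarFunctional (p ^ e) A x, polarFunctional (p ^ e) A z]))
  have h4 : (Submodule.span k (Set.range
      ![polarFunctional (p ^ e) A x, polarFunctional (p ^ e) A z])).dualCoannihilator =
      LinearMap.ker (polarFunctional (p ^ e) A x) ⊓
      LinearMap.ker (polarFunctional (p ^ e) A z) := by
    ext y
    rw [← SetLike.mem_coe, Submodule.coe_dualCoannihilator_span]
    simp [and_comm]
  rw [h2, h4, finrank_fin_fun] at h3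
  simp only [Fintype.card_fin] at h3
  omega

theorem exists_pow_ne_self [IsAlgClosed k] {q : ℕ} (hq : 1 < q) : ∃ t : k, t ^ q ≠ t := by
  by_contra! h
  refine FiniteField.X_pow_card_sub_X_ne_zero k hq (Polynomial.funext fun t => ?_)
  simp [h t]

/-- If the Frobenius form vanishes on a subspace, so does its polar form. -/
theorem polarFunctional_eq_zero_of_forall_self [IsAlgClosed k] (he : 0 < e)
    {A : Matrix (Fin n) (Fin n) k} {W : Submodule k (Fin n → k)}
    (h : ∀ u ∈ W, polarFunctional (p ^ e) A u u = 0) {u v : Fin n → k} (hu : u ∈ W) (hv : v ∈ W) :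
    polarFunctional (p ^ e) A u v = 0 := by
  -- Expanding F on u + t v mixes h(u, v) and h(v, u) with weights t and t^q; comparing t with 1
  -- separates them once t^q ≠ t.
  obtain ⟨t, ht⟩ := exists_pow_ne_self (k := k)
    (Nat.one_lt_pow he.ne' (Fact.out : p.Prime).one_lt)
  have key : ∀ t : k, t * polarFunctional (p ^ e) A u v
      + t ^ p ^ e * polarFunctional (p ^ e) A v u = 0 := by
    intro t
    have h1 := h (u + t • v) (W.add_mem hu (W.smul_mem t hv))
    simp only [polarFunctional_add, polarFunctional_smul, map_add, map_smul, LinearMap.add_apply,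
      LinearMap.smul_apply, smul_eq_mul, h u hu, h v hv] at h1
    linear_combination h1
  have h1 := key 1
  have h2 := key t
  rw [one_pow] at h1
  have h3 : (t - t ^ p ^ e) * polarFunctional (p ^ e) A u v = 0 := by
    linear_combination h2 - t ^ p ^ e * h1
  exact (mul_eq_zero.1 h3).resolve_left (sub_ne_zero.2 ht.symm)

end CharP

/-! ### Rational points as Frobenius-fixed points -/

theorem mem_subfield_iff_pow_eq {K : Subfield k} {m : ℕ} (hm : 1 < m) (hK : Nat.card K = m)
    (a : k) : a ∈ K ↔ a ^ m = a := by
  classical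
  have : Finite K := Nat.finite_of_card_ne_zero (by omega)
  have : Fintype K := Fintype.ofFinite K
  have hK' : Fintype.card K = m := by rw [← Nat.card_eq_fintype_card, hK]
  have hmem : ∀ b ∈ K, b ^ m = b := fun b hb => by
    have := FiniteField.pow_card (⟨b, hb⟩ : K)
    rw [hK'] at this
    exact congrArg Subtype.val this
  refine ⟨hmem a, fun ha => ?_⟩
  have hne := FiniteField.X_pow_card_sub_X_ne_zero k hm
  have hsub : (K : Set k).toFinset ⊆
      (Polynomial.X ^ m - Polynomial.X : Polynomial k).roots.toFinset := by
    intro b hb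
    rw [Set.mem_toFinset] at hb
    simp [Polynomial.mem_roots hne, hmem b hb]
  have hcard : (Polynomial.X ^ m - Polynomial.X : Polynomial k).roots.toFinset.card ≤
      (K : Set k).toFinset.card := by
    refine (Multiset.toFinset_card_le _).trans ((Polynomial.card_roots' _).trans ?_)
    rw [FiniteField.X_pow_card_sub_X_natDegree_eq k hm, Set.toFinset_card]
    exact hK'.ge
  have := Finset.eq_of_subset_of_card_le hsub hcard
  have ha' : a ∈ (K : Set k).toFinset := by
    rw [this]
    simp [Polynomial.mem_roots hne, ha]
  simpa using ha'

/-- Scaling a nonzero coordinate to 1 turns "fixed up to a scalar" into "fixed". -/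
theorem isRationalPoint_mk_of_pow_eq_smul {K : Subfield k} {m : ℕ} (hm : 1 < m)
    (hK : Nat.card K = m) {x : Fin n → k} (hx : x ≠ 0) {c : k} (h : x = c • x ^ m) :
    IsRationalPoint K (Projectivization.mk k x hx) := by
  obtain ⟨i, hi⟩ := Function.ne_iff.1 hx
  rw [Pi.zero_apply] at hi
  have hinv : (x i)⁻¹ ≠ 0 := inv_ne_zero hi
  refine ⟨(x i)⁻¹ • x, smul_ne_zero hinv hx, fun j => ?_, ?_⟩
  · rw [mem_subfield_iff_pow_eq hm hK]
    have hc (l) : x l = c * x l ^ m := congrFun h l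
    simp only [Pi.smul_apply, smul_eq_mul, mul_pow, inv_pow]
    have hpow : x i ^ m ≠ 0 := pow_ne_zero _ hi
    field_simp
    calc x j ^ m * x i = x j ^ m * (c * x i ^ m) := by rw [← hc]
      _ = x i ^ m * (c * x j ^ m) := by ring
      _ = x i ^ m * x j := by rw [← hc]
  · rw [Projectivization.mk_eq_mk_iff']
    exact ⟨x i, by rw [smul_smul, mul_inv_cancel₀ hi, one_smul]⟩

theorem finrank_span_pair {x y : Fin n → k} (h : LinearIndependent k ![x, y]) :
    finrank k (Submodule.span k {x, y}) = 2 := by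
  have := finrank_span_eq_card h
  rwa [Matrix.range_cons_cons_empty, Fintype.card_fin] at this

/-! ### Lines through nonrational and rational points -/

variable {p e : ℕ} [Fact p.Prime] [CharP k p] [IsAlgClosed k]

/-- Through a nonrational point passes at most one line of a smooth Hermitian surface. -/
theorem isLineOn_unique_of_not_isRationalPoint (he : 0 < e) {A : Matrix (Fin 4) (Fin 4) k}
    (hH : (A.map (fun a => a ^ p ^ e)).transpose = A)
    (hA : ∀ w, Matrix.vecMul w A = 0 → w = 0)
    {K : Subfield k} (hK : Nat.card K = (p ^ e) ^ 2)
    {P : ℙ k (Fin 4 → k)} (hP : ¬ IsRationalPoint K P) {W W' : Submodule k (Fin 4 → k)}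
    (hW : IsLineOn (frobeniusForm (p ^ e) A) W) (hPW : P.submodule ≤ W)
    (hW' : IsLineOn (frobeniusForm (p ^ e) A) W') (hPW' : P.submodule ≤ W') : W = W' := by
  have hq : 1 < p ^ e := Nat.one_lt_pow he.ne' (Fact.out : p.Prime).one_lt
  have hm : 1 < (p ^ e) ^ 2 := Nat.one_lt_pow two_ne_zero hq
  induction P using Projectivization.ind with | _ x hx
  choose z hz using fun i => IsAlgClosed.exists_pow_nat_eq (x i) (zero_lt_one.trans hm)
  have hzx : z ^ (p ^ e) ^ 2 = x := funext hz
  have hind : LinearIndependent k ![x, z] := by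
    rw [LinearIndependent.pair_iff' hx]
    rintro c rfl
    refine hP (isRationalPoint_mk_of_pow_eq_smul hm hK hx (c := c ^ (p ^ e) ^ 2) ?_)
    rw [smul_pow] at hzx
    exact hzx.symm
  have hdim := finrank_add_two_le_of_polarFunctional_eq_zero (p := p) (e := e) hA hind
  have key : ∀ V : Submodule k (Fin 4 → k), IsLineOn (frobeniusForm (p ^ e) A) V →
      (Projectivization.mk k x hx).submodule ≤ V →
      V = LinearMap.ker (polarFunctional (p ^ e) A x) ⊓
        LinearMap.ker (polarFunctional (p ^ e) A z) := by
    intro V hV hPV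
    obtain ⟨hV2, hV⟩ := (isLineOn_iff A V).1 hV
    have hxV : x ∈ V := by
      rw [Projectivization.submodule_mk] at hPV
      exact hPV (Submodule.mem_span_singleton_self x)
    refine Submodule.eq_of_le_of_finrank_eq (fun y hy => ⟨?_, ?_⟩) (by omega)
    · exact polarFunctional_eq_zero_of_forall_self he hV hxV hy
    · refine (pow_eq_zero_iff (zero_lt_one.trans hq).ne').1 ?_
      rw [polarFunctional_pow hH, hzx]
      exact polarFunctional_eq_zero_of_forall_self he hV hy hxV
  rw [key W hW hPW, key W' hW' hPW']

/-- A separable polynomial over an algebraically closed field has as many roots as its degree. -/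
theorem card_roots_toFinset_of_no_common_root [DecidableEq k] {f : Polynomial k}
    (h : ∀ t, f.eval t = 0 → f.derivative.eval t ≠ 0) : f.roots.toFinset.card = f.natDegree := by
  have hnd : f.roots.Nodup := by
    rw [Multiset.nodup_iff_count_le_one]
    intro t
    rw [Polynomial.count_roots]
    by_contra! hlt
    have h0 : f ≠ 0 := by
      rintro rfl
      simp at hlt
    obtain ⟨h1, h2⟩ := (Polynomial.one_lt_rootMultiplicity_iff_isRoot h0).1 hlt
    exact h t h1 h2
  rw [Multiset.toFinset_card_of_nodup hnd]
  exact (IsAlgClosed.splits f).natDegree_eq_card_roots.symm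

theorem isStarPoint_of_isRationalPoint (he : 0 < e) {A : Matrix (Fin 4) (Fin 4) k}
    (hH : (A.map (fun a => a ^ p ^ e)).transpose = A)
    (hA : ∀ w, Matrix.vecMul w A = 0 → w = 0)
    (hdeg : (frobeniusForm (p ^ e) A).totalDegree = p ^ e + 1)
    {K : Subfield k} (hK : Nat.card K = (p ^ e) ^ 2)
    {P : ℙ k (Fin 4 → k)} (hPX : P ∈ zeroLocus (frobeniusForm (p ^ e) A))
    (hP : IsRationalPoint K P) : IsStarPoint (frobeniusForm (p ^ e) A) P := by
  classical
  have hq : 1 < p ^ e := Nat.one_lt_pow he.ne' (Fact.out : p.Prime).one_lt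
  have hq0 : p ^ e ≠ 0 := (zero_lt_one.trans hq).ne'
  have hm : 1 < (p ^ e) ^ 2 := Nat.one_lt_pow two_ne_zero hq
  obtain ⟨x, hx, hxK, rfl⟩ := hP
  have hxq : x ^ (p ^ e) ^ 2 = x := funext fun i => (mem_subfield_iff_pow_eq hm hK _).1 (hxK i)
  have hxx : polarFunctional (p ^ e) A x x = 0 := by
    rw [← eval_frobeniusForm]
    refine hPX x ?_
    rw [Projectivization.submodule_mk]
    exact Submodule.mem_span_singleton_self x
  set T := LinearMap.ker (polarFunctional (p ^ e) A x) with hT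
  have hxT : x ∈ T := hxx
  have hTx : ∀ y ∈ T, polarFunctional (p ^ e) A y x = 0 := by
    intro y hy
    have h := polarFunctional_pow hH x y
    rw [hxq, show polarFunctional (p ^ e) A x y = 0 from hy, zero_pow hq0] at h
    exact h.symm
  have hT3 : 3 ≤ finrank k T := by
    have h1 := LinearMap.finrank_range_add_finrank_ker (polarFunctional (p ^ e) A x)
    have h2 := Submodule.finrank_le (LinearMap.range (polarFunctional (p ^ e) A x))
    rw [finrank_self] at h2
    rw [finrank_fin_fun, ← hT] at h1
    omega
  -- a vector of the tangent space whose polar contains the tangent space is proportional to `x`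
  have hprop : ∀ w, T ≤ LinearMap.ker (polarFunctional (p ^ e) A w) →
      w ∈ Submodule.span k {x} := by
    intro w hw
    by_contra hwx
    have hind : LinearIndependent k ![x, w] := by
      rw [LinearIndependent.pair_iff' hx]
      intro a ha
      exact hwx (Submodule.mem_span_singleton.2 ⟨a, ha⟩)
    have hdim := finrank_add_two_le_of_polarFunctional_eq_zero (p := p) (e := e) hA hind
    rw [← hT, inf_eq_left.2 hw] at hdim
    omega
  -- Otherwise h vanishes on T × T, and `hprop` forces T into the span of x. A nonzero value at y₂
  -- gives the polynomial below full degree q + 1, so no line is lost at infinity.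
  obtain ⟨y₂, hy₂T, hy₂⟩ : ∃ y ∈ T, polarFunctional (p ^ e) A y y ≠ 0 := by
    by_contra! h
    have hle : T ≤ Submodule.span k {x} := fun u hu => hprop u fun v hv =>
      polarFunctional_eq_zero_of_forall_self he h hu hv
    have := Submodule.finrank_mono hle
    rw [finrank_span_singleton hx] at this
    omega
  have hy₂x : y₂ ∉ Submodule.span k {x} := by
    intro h
    obtain ⟨a, rfl⟩ := Submodule.mem_span_singleton.1 h
    apply hy₂
    rw [polarFunctional_smul, LinearMap.smul_apply, map_smul, hxx, smul_zero, smul_zero]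
  have h2 : finrank k (Submodule.span k {x, y₂}) = 2 := by
    have hi : LinearIndependent k ![x, y₂] := by
      rw [LinearIndependent.pair_iff' hx]
      intro a ha
      exact hy₂x (Submodule.mem_span_singleton.2 ⟨a, ha⟩)
    exact finrank_span_pair hi
  obtain ⟨y₁, hy₁T, hy₁⟩ : ∃ y ∈ T, y ∉ Submodule.span k {x, y₂} := by
    by_contra! h
    have h1 := Submodule.finrank_mono (show T ≤ Submodule.span k {x, y₂} from h)
    omega
  have hind : ∀ t : k, LinearIndependent k ![x, y₁ + t • y₂] := by
    intro t
    rw [LinearIndependent.pair_iff' hx]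
    intro a ha
    refine hy₁ (Submodule.mem_span_pair.2 ⟨a, -t, ?_⟩)
    rw [ha]
    module
  have hTspan : T = Submodule.span k {x, y₂} ⊔ Submodule.span k {y₁} := by
    have hle : Submodule.span k {x, y₂} ⊔ Submodule.span k {y₁} ≤ T := by
      rw [sup_le_iff, Submodule.span_le, Submodule.span_le]
      simp [Set.insert_subset_iff, hxT, hy₁T, hy₂T]
    refine (Submodule.eq_of_le_of_finrank_le hle ?_).symm
    have hlt : Submodule.span k {x, y₂} < Submodule.span k {x, y₂} ⊔ Submodule.span k {y₁} := by
      refine lt_of_le_of_ne le_sup_left fun h => hy₁ ?_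
      rw [h]
      exact Submodule.mem_sup_right (Submodule.mem_span_singleton_self y₁)
    have h3 := Submodule.finrank_lt_finrank_of_lt hlt
    have h4 : finrank k T ≤ 3 := by
      have hne : T ≠ ⊤ := by
        intro h
        have h0 : x ∈ Submodule.span k {(0 : Fin 4 → k)} := by
          have h5 : polarFunctional (p ^ e) A x = 0 := LinearMap.ker_eq_top.1 h
          have h6 : x ^ p ^ e = 0 := by
            refine hA _ (funext fun i => ?_)
            have h2 := LinearMap.congr_fun h5 (Pi.single i 1)
            rwa [polarFunctional_single] at h2
          exact absurd (funext fun i => (pow_eq_zero_iff hq0).1 (congrFun h6 i)) hx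
        simp [hx] at h0
      have := Submodule.finrank_lt (lt_top_iff_ne_top.2 hne).ne
      rw [finrank_fin_fun] at this
      omega
    omega
  -- the restriction of the form to the pencil of lines through `x` in the tangent plane
  set a := polarFunctional (p ^ e) A y₁ y₁ with ha
  set b := polarFunctional (p ^ e) A y₁ y₂ with hb
  set c := polarFunctional (p ^ e) A y₂ y₁ with hc
  set d := polarFunctional (p ^ e) A y₂ y₂ with hd
  set f : Polynomial k := Polynomial.C d * Polynomial.X ^ (p ^ e + 1) +
    (Polynomial.C c * Polynomial.X ^ p ^ e + Polynomial.C b * Polynomial.X + Polynomial.C a) with hf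
  have hfdeg : f.natDegree = p ^ e + 1 := by
    rw [hf, Polynomial.natDegree_add_eq_left_of_natDegree_lt, Polynomial.natDegree_C_mul_X_pow _ _ hy₂]
    rw [Polynomial.natDegree_C_mul_X_pow _ _ hy₂]
    refine Nat.lt_succ_of_le ?_
    compute_degree
    omega
  have hfeval : ∀ t, f.eval t = polarFunctional (p ^ e) A (y₁ + t • y₂) (y₁ + t • y₂) := by
    intro t
    simp only [hf, polarFunctional_add, polarFunctional_smul, map_add, map_smul,
      LinearMap.add_apply, LinearMap.smul_apply, smul_eq_mul, ← ha, ← hb, ← hc, ← hd,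
      Polynomial.eval_add, Polynomial.eval_mul, Polynomial.eval_C, Polynomial.eval_pow,
      Polynomial.eval_X]
    ring
  have hf'eval : ∀ t, f.derivative.eval t = polarFunctional (p ^ e) A (y₁ + t • y₂) y₂ := by
    intro t
    -- In characteristic p, X^(q+1) has derivative X^q and X^q has derivative 0.
    have h1 : f.derivative.eval t = d * t ^ p ^ e + b := by
      simp [hf, he.ne', Polynomial.derivative_X_pow]
    rw [h1, polarFunctional_add, polarFunctional_smul, LinearMap.add_apply, LinearMap.smul_apply,
      smul_eq_mul]
    ring
  have hcard : f.roots.toFinset.card = p ^ e + 1 := by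
    rw [← hfdeg]
    refine card_roots_toFinset_of_no_common_root fun t h1 h2 => ?_
    rw [hfeval] at h1
    rw [hf'eval] at h2
    have h3 : polarFunctional (p ^ e) A (y₁ + t • y₂) y₁ = 0 := by
      rw [map_add, map_smul, h2, smul_zero, add_zero] at h1
      exact h1
    -- At a double root the polar of y₁ + t y₂ kills x, y₁ and y₂, hence all of T.
    have h4 := hprop (y₁ + t • y₂) (by
      rw [hTspan, sup_le_iff, Submodule.span_le, Submodule.span_le]
      simp only [Set.insert_subset_iff, Set.singleton_subset_iff, SetLike.mem_coe,
        LinearMap.mem_ker]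
      exact ⟨⟨hTx _ (T.add_mem hy₁T (T.smul_mem t hy₂T)), h2⟩, h3⟩)
    obtain ⟨s, hs⟩ := Submodule.mem_span_singleton.1 h4
    exact (LinearIndependent.pair_iff' hx).1 (hind t) s hs
  refine ⟨f.roots.toFinset.image fun t => Submodule.span k {x, y₁ + t • y₂}, ?_, ?_⟩
  · rw [hdeg, Finset.card_image_of_injective, hcard]
    intro t t' htt
    by_contra hne
    simp only at htt
    have h1 : y₁ + t • y₂ ∈ Submodule.span k {x, y₁ + t' • y₂} :=
      htt ▸ Submodule.subset_span (by simp)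
    obtain ⟨r, s, hrs⟩ := Submodule.mem_span_pair.1 h1
    -- Comparing y₁-coefficients: s = 1 puts y₂ in the span of x, any other s puts y₁ in the span of
    -- x and y₂.
    by_cases hs : s = 1
    · apply hy₂x
      refine Submodule.mem_span_singleton.2 ⟨(t - t')⁻¹ * r, ?_⟩
      have hr : r • x = (t - t') • y₂ := by
        rw [hs] at hrs
        linear_combination (norm := module) hrs
      rw [mul_smul, hr, smul_smul, inv_mul_cancel₀ (sub_ne_zero.2 hne), one_smul]
    · apply hy₁
      have hs' : 1 - s ≠ 0 := sub_ne_zero.2 (Ne.symm hs)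
      refine Submodule.mem_span_pair.2 ⟨(1 - s)⁻¹ * r, (1 - s)⁻¹ * (s * t' - t), ?_⟩
      have hr : r • x + (s * t' - t) • y₂ = (1 - s) • y₁ := by
        linear_combination (norm := module) hrs
      rw [mul_smul, mul_smul, ← smul_add, hr, smul_smul, inv_mul_cancel₀ hs', one_smul]
  · intro W hW
    obtain ⟨t, ht, rfl⟩ := Finset.mem_image.1 hW
    have ht0 : polarFunctional (p ^ e) A (y₁ + t • y₂) (y₁ + t • y₂) = 0 := by
      rw [← hfeval]
      exact Polynomial.isRoot_of_mem_roots (Multiset.mem_toFinset.1 ht)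
    have hwT : y₁ + t • y₂ ∈ T := T.add_mem hy₁T (T.smul_mem t hy₂T)
    refine ⟨(isLineOn_iff A _).2 ⟨?_, ?_⟩, ?_⟩
    · exact finrank_span_pair (hind t)
    · intro u hu
      obtain ⟨r, s, rfl⟩ := Submodule.mem_span_pair.1 hu
      generalize y₁ + t • y₂ = w at ht0 hwT
      have h1 : polarFunctional (p ^ e) A x w = 0 := hwT
      simp [polarFunctional_add, polarFunctional_smul, hxx, ht0, hTx w hwT, h1]
    · rw [Projectivization.submodule_mk]
      exact Submodule.span_mono (by simp)

end ExtremalSurface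

theorem mainTheorem11 {k : Type*} [Field k] [IsAlgClosed k] (p : ℕ) [Fact p.Prime] [CharP k p]
    (e : ℕ) (he : 0 < e) (q : ℕ) (hq : q = p ^ e)
    (Fq2 : Subfield k) (hFq2 : Nat.card Fq2 = q ^ 2)
    (F : MvPolynomial (Fin 4) k) (hF : ExtremalSurface.IsHermitianForm q F)
    (hsmooth : ExtremalSurface.IsSmoothHypersurface F) :
    {P : Projectivization k (Fin 4 → k) | ExtremalSurface.IsStarPoint F P} =
      {P : Projectivization k (Fin 4 → k) |
        P ∈ ExtremalSurface.zeroLocus F ∧ ExtremalSurface.IsRationalPoint Fq2 P} := by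
  obtain ⟨A, hH, rfl⟩ := hF
  subst hq
  have hA := ExtremalSurface.vecMul_injective_of_isSmooth he hsmooth
  have hdeg := ExtremalSurface.totalDegree_of_isSmooth hsmooth
  have hq : 1 < p ^ e := Nat.one_lt_pow he.ne' (Fact.out : p.Prime).one_lt
  ext P
  refine ⟨?_, fun h =>
    ExtremalSurface.isStarPoint_of_isRationalPoint he hH hA hdeg hFq2 h.1 h.2⟩
  rintro ⟨S, hS, hlines⟩
  rw [hdeg] at hS
  -- Two distinct lines through P already force rationality.
  obtain ⟨W, hW, W', hW', hne⟩ := Finset.one_lt_card.1 (show 1 < S.card by omega)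
  refine ⟨(hlines W hW).1.2 P (hlines W hW).2, ?_⟩
  by_contra hP
  exact hne (ExtremalSurface.isLineOn_unique_of_not_isRationalPoint he hH hA hFq2 hP
    (hlines W hW).1 (hlines W hW).2 (hlines W' hW').1 (hlines W' hW').2)
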